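/- Let $G=(V,E,w)$ be a finite connected graph (self-loops allowed) with Hermitian complex weights $w_{uv}=\overline{w_{vu}}$ ($w_{uv}=0$ if $uv\notin E$), and let $A_G=(w_{uv})_{u,v\in V}$. Assume $G$ is semi-bipartite with parts $V_1,V_2$: $V=V_1\sqcup V_2$ and no edge runs within $V_1$ (edges and self-loops within $V_2$ are allowed). Let $P\subseteq V_1$, and let $G-p$ be $G$ with the vertex $p$ removed. Assume $|V_1|=|V_2|+1$ and that at least one of the following holds: (2a) $\det(A_{G-p})\neq 0$ for every $p\in P$; (2b) $A_G$ has, up to scalars, a unique zero eigenvector, and this vector has nonzero amplitude on every $p\in P$. Let $a,b\in P$ and $T>0$. Let $f_v:[0,T]\to\mathbb{C}$ ($v\in V_1$) be continuous controls with $f_a(0)=0$, $f_b(T)=0$, $f_v(t)\neq0$ for all $v\in V_1\setminus P$ and $t\in[0,T]$, and such that no two of the $f_v$, for distinct $v\in V_1$, vanish at the same time. Let $H(t)=\sum_{u,v\in V}f_{uv}(t)\,w_{uv}\,|u\rangle\langle v|$ be the control Hamiltonian with the commensurate couplings $f_{vu}=f_v$, $f_{uv}=\overline{f_v}$ for $v\in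 V_1$, $u\in V_2$, and $f_{uv}=1$ for $u,v\in V_2$. Then: 1. for every $t\in[0,T]$ the kernel of $H(t)$ is one-dimensional; 2. there is a continuous family $z(t)$, $t\in[0,T]$, of unit vectors with $H(t)z(t)=0$, with $z(0)=|a\rangle$ and $z(T)=c\,|b\rangle$ for some phase $|c|=1$; 3. there is $\varepsilon>0$ such that $|\mu|\ge\varepsilon$ for every $t\in[0,T]$ and every nonzero eigenvalue $\mu$ of $H(t)$; 4. if moreover the controls $f_v$ are absolutely continuous on $[0,T]$ (for example Lipschitz, piecewise $C^1$ or smooth), then for every $\hbar>0$ the protocol adiabatically transfers amplitude from $a$ to $b$: the family $z$ in 2 can be chosen so that for every $\delta>0$ there is $\tau_0>0$ such that for all $\tau\ge\tau_0$ the Schrödinger equation $i\hbar\,\psi'(t)=H(Tt/\tau)\,\psi(t)$ on $[0,\tau]$ has a solution with $\psi(0)=|a\rangle$, and every such solution satisfies $\|\psi(t)-z(Tt/\tau)\|\le\delta$ for all $t\in[0,\tau]$. In particular $\psi(\tau)$ is within $\delta$ of a unit multiple of $|b\rangle$. -/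

import Mathlib

/-- A weighted graph (loops allowed) with Hermitian complex weights, supported on the edges. -/
structure WeightedGraph (V : Type*) where
  /-- `u` and `v` are joined by an edge; `Adj v v` is a self-loop. -/
  Adj : V → V → Prop
  symm : ∀ u v, Adj u v → Adj v u
  weight : V → V → ℂ
  weight_eq_zero : ∀ u v, ¬ Adj u v → weight u v = 0
  weight_conj : ∀ u v, weight u v = star (weight v u)

namespace WeightedGraph

variable {V : Type*}

/-- The underlying graph is connected (self-loops are irrelevant for this). -/
def Connected (G : WeightedGraph V) : Prop :=
  (SimpleGraph.fromRel G.Adj).Connected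

/-- The matrix of weights. -/
def adjMatrix (G : WeightedGraph V) : Matrix V V ℂ :=
  Matrix.of fun u v => G.weight u v

/-- The graph `G - p`: the vertex `p` and all edges incident to it are removed. -/
def deleteVertex (G : WeightedGraph V) (p : V) : WeightedGraph {v : V // v ≠ p} where
  Adj u v := G.Adj u v
  symm u v := G.symm u v
  weight u v := G.weight u v
  weight_eq_zero u v := G.weight_eq_zero u v
  weight_conj u v := G.weight_conj u v

/-- `V = V₁ ⊔ V₂`, and there is no edge (and no self-loop) within `V₁`. -/
structure IsSemiBipartite [Fintype V] [DecidableEq V] (G : WeightedGraph V)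
    (V₁ V₂ : Finset V) : Prop where
  isCompl : IsCompl V₁ V₂
  not_adj : ∀ u ∈ V₁, ∀ v ∈ V₁, ¬ G.Adj u v

/-- The control Hamiltonian `∑_{u,v} f_{uv}(t) w_{uv} |u⟩⟨v|`. -/
def controlHamiltonian (G : WeightedGraph V) (f : V → V → ℝ → ℂ) (t : ℝ) : Matrix V V ℂ :=
  Matrix.of fun u v => f u v t * G.weight u v

end WeightedGraph

/-- The couplings `f_{uv}` are Hermitian and commensurate on the time interval `[0, T]`, with the
control `g v` on all couplings between `v ∈ V₁` and `V₂`. -/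
structure IsCommensurate {V : Type*} (V₁ V₂ : Finset V) (T : ℝ) (f : V → V → ℝ → ℂ)
    (g : V → ℝ → ℂ) : Prop where
  conj : ∀ t ∈ Set.Icc 0 T, ∀ u v, f u v t = star (f v u t)
  between : ∀ t ∈ Set.Icc 0 T, ∀ v ∈ V₁, ∀ u ∈ V₂, f v u t = g v t
  within : ∀ t ∈ Set.Icc 0 T, ∀ v ∈ V₂, ∀ u ∈ V₂, f v u t = 1

/-- The control scheme for a transfer from `a` to `b` in the time interval `[0, T]`. -/
structure IsTransferScheme {V : Type*} (V₁ P : Finset V) (a b : V) (T : ℝ)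
    (g : V → ℝ → ℂ) : Prop where
  continuousOn : ∀ v ∈ V₁, ContinuousOn (g v) (Set.Icc 0 T)
  start : g a 0 = 0
  finish : g b T = 0
  ne_zero : ∀ v ∈ V₁, v ∉ P → ∀ t ∈ Set.Icc 0 T, g v t ≠ 0
  not_both_zero : ∀ u ∈ V₁, ∀ v ∈ V₁, u ≠ v → ∀ t ∈ Set.Icc 0 T, ¬ (g u t = 0 ∧ g v t = 0)

section Hamiltonians

variable {V : Type*} [Fintype V] [DecidableEq V]

/-- The zero-energy subspace of a Hamiltonian. -/
noncomputable def zeroSpace (A : Matrix V V ℂ) : Submodule ℂ (EuclideanSpace ℂ V) :=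
  LinearMap.ker (Matrix.toEuclideanLin A)

/-- `A` has, up to scalars, exactly one zero eigenvector. -/
def HasUniqueZeroEigenvector (A : Matrix V V ℂ) : Prop :=
  Module.finrank ℂ (zeroSpace A) = 1

/-- `z` is a continuous family of normalized zero eigenstates of `H t`, `t ∈ [0, T]`, equal to `|a⟩`
at time `0` and, up to a phase, to `|b⟩` at time `T`. -/
structure IsZeroEigenstatePath (H : ℝ → Matrix V V ℂ) (T : ℝ) (a b : V)
    (z : ℝ → EuclideanSpace ℂ V) : Prop where
  continuousOn : ContinuousOn z (Set.Icc 0 T)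
  norm_eq_one : ∀ t ∈ Set.Icc 0 T, ‖z t‖ = 1
  mem_zeroSpace : ∀ t ∈ Set.Icc 0 T, z t ∈ zeroSpace (H t)
  start : z 0 = EuclideanSpace.single a 1
  finish : ∃ c : ℂ, ‖c‖ = 1 ∧ z T = c • EuclideanSpace.single b 1

/-- All nonzero eigenvalues of all `H t`, `t ∈ [0, T]`, have modulus at least `ε`. -/
def HasGapAroundZero (H : ℝ → Matrix V V ℂ) (T ε : ℝ) : Prop :=
  ∀ t ∈ Set.Icc 0 T, ∀ μ : ℂ,
    Module.End.HasEigenvalue (Matrix.toEuclideanLin (H t)) μ → μ ≠ 0 → ε ≤ ‖μ‖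

/-- `ψ` solves `i ℏ ψ' = H(t) ψ` on `[0, τ]` (one-sided derivatives at the endpoints). -/
def IsSchrodingerSolution (hbar : ℝ) (H : ℝ → Matrix V V ℂ) (τ : ℝ)
    (ψ : ℝ → EuclideanSpace ℂ V) : Prop :=
  ∀ t ∈ Set.Icc 0 τ, ∃ ψ' : EuclideanSpace ℂ V, HasDerivWithinAt ψ ψ' (Set.Icc 0 τ) t ∧
    (Complex.I * (hbar : ℂ)) • ψ' = Matrix.toEuclideanLin (H t) (ψ t)

/-- Adiabatic transfer from `a` to `b`: there is a continuous family `z` of zero eigenstates going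
from `|a⟩` to `|b⟩` such that, when the protocol `H t`, `t ∈ [0, T]`, is stretched to a total
duration `τ`, the Schrödinger evolution started in `|a⟩` exists and follows `z`, uniformly over the
protocol, to any accuracy `δ` as soon as `τ` is large enough. -/
def AdiabaticallyTransfers (hbar : ℝ) (H : ℝ → Matrix V V ℂ) (T : ℝ) (a b : V) : Prop :=
  ∃ z : ℝ → EuclideanSpace ℂ V, IsZeroEigenstatePath H T a b z ∧
    ∀ δ > 0, ∃ τ₀ > 0, ∀ τ ≥ τ₀,
      (∃ ψ : ℝ → EuclideanSpace ℂ V,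
        IsSchrodingerSolution hbar (fun t => H (T * t / τ)) τ ψ ∧
          ψ 0 = EuclideanSpace.single a 1) ∧
      ∀ ψ : ℝ → EuclideanSpace ℂ V,
        IsSchrodingerSolution hbar (fun t => H (T * t / τ)) τ ψ →
        ψ 0 = EuclideanSpace.single a 1 →
        ∀ t ∈ Set.Icc 0 τ, ‖ψ t - z (T * t / τ)‖ ≤ δ

end Hamiltonians

/-! Let `B` be the block of weights from `V₁` to `V₂`. Since `|V₁| = |V₂| + 1`, it has a nonzero
kernel vector `x`; either alternative of the hypothesis makes `ker B` the line of `x`, with `x`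
nonzero on `P`, and then the adjoint of `B` is injective. Commensurate controls only rescale the
`V₁` side of the block, so `x v * ∏_{u ≠ v} star (g u t)`, supported on `V₁`, is a zero eigenvector
of `H t`. Clearing denominators keeps it polynomial in the controls: where `g p` vanishes it becomes
a nonzero multiple of `|p⟩`, which gives the endpoints `a` and `b`.
`IsScaledHamiltonian.exists_eq_smul_kernelVector` shows that there are no other zero eigenvectors.

Adding the projection onto the unit kernel vector `z` makes `H` invertible. The inverse is
continuous in time, hence bounded on `[0, T]`, which yields the gap.

For the dynamics, rescale `z` so that `z' ⟂ z`; there is no dynamical phase because the energy is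
zero. Then `z' = H y` for an integrable `y`, which is replaced by a smooth one up to a small `L¹`
error. With `φ' = -i l H φ`, the overlap `⟪z, φ⟫` corrected by `-(i/l) ⟪y, φ⟫` is almost conserved,
since the fast terms cancel. So the overlap stays near `1` for large `l`, and both vectors have norm
one (`adiabatic_following`). -/

open MeasureTheory Set Filter Topology
open scoped NNReal ENNReal ContDiff

/-! ### Absolutely continuous curves in finite-dimensional spaces -/

namespace AbsolutelyContinuousOnInterval

variable {X Y : Type*} [PseudoMetricSpace X] [PseudoMetricSpace Y]

theorem of_dist_le {f : ℝ → X} {g : ℝ → Y} {a b : ℝ} (K : ℝ)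
    (hg : AbsolutelyContinuousOnInterval g a b)
    (h : ∀ x ∈ uIcc a b, ∀ y ∈ uIcc a b, dist (f x) (f y) ≤ K * dist (g x) (g y)) :
    AbsolutelyContinuousOnInterval f a b := by
  have hK := Tendsto.const_mul K hg
  rw [mul_zero] at hK
  refine squeeze_zero' (Eventually.of_forall fun t => Finset.sum_nonneg fun i _ => dist_nonneg)
    ?_ hK
  filter_upwards [mem_inf_of_right (mem_principal_self _)] with E hE
  rw [Finset.mul_sum]
  exact Finset.sum_le_sum fun i hi => h _ (hE.1 i hi).1 _ (hE.1 i hi).2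

theorem prodMk {f : ℝ → X} {g : ℝ → Y} {a b : ℝ}
    (hf : AbsolutelyContinuousOnInterval f a b) (hg : AbsolutelyContinuousOnInterval g a b) :
    AbsolutelyContinuousOnInterval (fun t => (f t, g t)) a b := by
  refine squeeze_zero (fun t => Finset.sum_nonneg fun i _ => dist_nonneg) (fun E => ?_)
    (by simpa using Tendsto.add hf hg)
  rw [← Finset.sum_add_distrib]
  refine Finset.sum_le_sum fun i _ => ?_
  rw [Prod.dist_eq]
  exact max_le_add_of_nonneg dist_nonneg dist_nonneg

variable {E F : Type*} [NormedAddCommGroup E] [NormedSpace ℝ E] [FiniteDimensional ℝ E]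
  [NormedAddCommGroup F] [NormedSpace ℝ F]

/-- The curve stays in a compact ball, on which a `C¹` map is Lipschitz. -/
theorem contDiff_comp {Φ : E → F} (hΦ : ContDiff ℝ 1 Φ) {f : ℝ → E} {a b : ℝ}
    (hf : AbsolutelyContinuousOnInterval f a b) :
    AbsolutelyContinuousOnInterval (fun t => Φ (f t)) a b := by
  obtain ⟨C, hC⟩ := hf.exists_bound
  have := FiniteDimensional.proper ℝ E
  obtain ⟨K, hK⟩ := (hΦ.contDiffOn (s := Metric.closedBall 0 C)).exists_lipschitzOnWith
    (by decide) (convex_closedBall _ _) (isCompact_closedBall _ _)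
  refine hf.of_dist_le K fun x hx y hy => hK.dist_le_mul _ ?_ _ ?_
  · simpa using hC x hx
  · simpa using hC y hy

theorem ae_hasDerivAt {f : ℝ → E} {a b : ℝ}
    (hf : AbsolutelyContinuousOnInterval f a b) :
    ∀ᵐ x, x ∈ uIcc a b → HasDerivAt f (deriv f x) x := by
  filter_upwards [hf.boundedVariationOn.ae_differentiableAt_of_mem_uIcc] with x hx h
  exact (hx h).hasDerivAt

/-- Coordinates in a basis reduce this to the scalar case. -/
theorem intervalIntegrable_deriv_of_finiteDimensional {f : ℝ → E} {a b : ℝ}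
    (hf : AbsolutelyContinuousOnInterval f a b) :
    IntervalIntegrable (deriv f) volume a b := by
  let B := Module.finBasis ℝ E
  let c : ∀ i, E →L[ℝ] ℝ := fun i => LinearMap.toContinuousLinearMap (B.coord i)
  have hc : ∀ i, IntervalIntegrable (fun t => deriv (fun s => c i (f s)) t • B i) volume a b := by
    intro i
    have h := (hf.contDiff_comp (c i).contDiff).intervalIntegrable_deriv
    exact ⟨h.1.smul_const _, h.2.smul_const _⟩
  have hs := IntervalIntegrable.sum Finset.univ (f := fun i t =>
    deriv (fun s => c i (f s)) t • B i) fun i _ => hc i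
  refine hs.congr_ae ?_
  rw [Filter.EventuallyEq, ae_restrict_iff' measurableSet_uIoc]
  filter_upwards [hf.ae_hasDerivAt] with x hx hx'
  have h := hx (uIoc_subset_uIcc hx')
  conv_rhs => rw [← B.sum_repr (deriv f x)]
  rw [Finset.sum_apply]
  refine Finset.sum_congr rfl fun i _ => ?_
  have h2 : HasDerivAt (fun s => c i (f s)) (c i (deriv f x)) x :=
    (c i).hasFDerivAt.comp_hasDerivAt x h
  rw [h2.deriv]
  rfl

theorem _root_.IntervalIntegrable.absolutelyContinuousOnInterval_integral {f : ℝ → F} {a b : ℝ}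
    (h : IntervalIntegrable f volume a b) :
    AbsolutelyContinuousOnInterval (fun x => ∫ v in a..x, f v) a b := by
  refine (h.norm.absolutelyContinuousOnInterval_intervalIntegral
    (c := a) left_mem_uIcc).of_dist_le 1 fun x hx y hy => ?_
  have hi : ∀ x ∈ uIcc a b, IntervalIntegrable f volume a x := fun x hx =>
    h.mono_set (uIcc_subset_uIcc_left hx)
  rw [dist_eq_norm, dist_eq_norm, one_mul,
    intervalIntegral.integral_interval_sub_left (hi x hx) (hi y hy),
    intervalIntegral.integral_interval_sub_left (hi x hx).norm (hi y hy).norm]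
  exact intervalIntegral.norm_integral_le_abs_integral_norm

/-- Subtracting the primitive of the derivative leaves an absolutely continuous curve with
derivative zero almost everywhere, hence a constant. -/
theorem integral_deriv_eq_sub_of_finiteDimensional {f : ℝ → E} {a b : ℝ}
    (hf : AbsolutelyContinuousOnInterval f a b) :
    ∫ x in a..b, deriv f x = f b - f a := by
  have hi := hf.intervalIntegrable_deriv_of_finiteDimensional
  have hg := hf.sub hi.absolutelyContinuousOnInterval_integral
  have := FiniteDimensional.complete ℝ E
  obtain ⟨C, hC⟩ := hg.const_of_ae_hasDerivAt_zero (by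
    filter_upwards [hf.ae_hasDerivAt, hi.ae_hasDerivAt_integral] with x h₁ h₂ hx
    simpa using! (h₁ hx).sub (h₂ hx a left_mem_uIcc))
  have h1 := hC a left_mem_uIcc
  have h2 := hC b right_mem_uIcc
  simp only [Pi.sub_apply, intervalIntegral.integral_same, sub_zero] at h1 h2
  rw [h1, ← h2]
  abel

/-- A bound on the derivative bounds the increment. -/
theorem norm_sub_le_integral {f : ℝ → E} {B : ℝ → ℝ} {a b : ℝ} (hab : a ≤ b)
    (hf : AbsolutelyContinuousOnInterval f a b) (hB : IntervalIntegrable B volume a b)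
    (h : ∀ᵐ x, x ∈ uIcc a b → ‖deriv f x‖ ≤ B x) :
    ‖f b - f a‖ ≤ ∫ x in a..b, B x := by
  rw [← hf.integral_deriv_eq_sub_of_finiteDimensional]
  refine intervalIntegral.norm_integral_le_of_norm_le hab ?_ hB
  filter_upwards [h] with x hx hx'
  exact hx (uIoc_subset_uIcc (by rwa [uIoc_of_le hab]))

theorem inner_complex {G : Type*} [NormedAddCommGroup G] [InnerProductSpace ℂ G]
    [FiniteDimensional ℂ G] {f g : ℝ → G} {a b : ℝ}
    (hf : AbsolutelyContinuousOnInterval f a b) (hg : AbsolutelyContinuousOnInterval g a b) :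
    AbsolutelyContinuousOnInterval (fun t => inner ℂ (f t) (g t)) a b := by
  have : FiniteDimensional ℝ G := FiniteDimensional.complexToReal G
  exact (hf.prodMk hg).contDiff_comp (Φ := fun p : G × G => inner ℂ p.1 p.2)
    (contDiff_fst.inner ℂ contDiff_snd)

end AbsolutelyContinuousOnInterval

/-! ### Norm-preserving linear evolution -/

section Evolution

variable {E : Type*} [NormedAddCommGroup E] [InnerProductSpace ℂ E]

theorem norm_eq_of_hasDerivWithinAt_skew {φ φ' : ℝ → E} {T : ℝ}
    (hφ : ∀ t ∈ Icc 0 T, HasDerivWithinAt φ (φ' t) (Icc 0 T) t)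
    (hskew : ∀ t ∈ Icc 0 T, inner ℂ (φ t) (φ' t) + inner ℂ (φ' t) (φ t) = 0)
    {t : ℝ} (ht : t ∈ Icc 0 T) : ‖φ t‖ = ‖φ 0‖ := by
  have h : ∀ s ∈ Icc 0 T, HasDerivWithinAt (fun s => inner ℂ (φ s) (φ s)) 0 (Icc 0 T) s := by
    intro s hs
    have := (hφ s hs).inner ℂ (hφ s hs)
    rwa [hskew s hs] at this
  have h0 : (0 : ℝ) ∈ Icc 0 T := ⟨le_rfl, ht.1.trans ht.2⟩
  have h2 := (convex_Icc 0 T).norm_image_sub_le_of_norm_hasDerivWithin_le (C := 0) h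
    (fun s _ => by simp) h0 ht
  rw [zero_mul, norm_le_zero_iff, sub_eq_zero, inner_self_eq_norm_sq_to_K,
    inner_self_eq_norm_sq_to_K] at h2
  have h3 : ‖φ t‖ ^ 2 = ‖φ 0‖ ^ 2 := by exact_mod_cast h2
  exact (pow_left_inj₀ (norm_nonneg _) (norm_nonneg _) two_ne_zero).1 h3

/-- The radial retraction onto the closed unit ball. -/
noncomputable def unitBallRetraction (x : E) : E := ((max 1 ‖x‖ : ℝ) : ℂ)⁻¹ • x

theorem unitBallRetraction_eq_self {x : E} (hx : ‖x‖ ≤ 1) : unitBallRetraction x = x := by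
  simp [unitBallRetraction, max_eq_left hx]

theorem norm_unitBallRetraction_le (x : E) : ‖unitBallRetraction x‖ ≤ 1 := by
  have h : (0 : ℝ) < max 1 ‖x‖ := lt_max_of_lt_left one_pos
  rw [unitBallRetraction, norm_smul, norm_inv, Complex.norm_real, Real.norm_of_nonneg h.le,
    inv_mul_le_iff₀ h, mul_one]
  exact le_max_right _ _

theorem norm_unitBallRetraction_sub_le (x y : E) :
    ‖unitBallRetraction x - unitBallRetraction y‖ ≤ 2 * ‖x - y‖ := by
  set m := max 1 ‖x‖ with hm
  set n := max 1 ‖y‖ with hn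
  have hm1 : 1 ≤ m := le_max_left _ _
  have hn1 : 1 ≤ n := le_max_left _ _
  have hyn : ‖y‖ ≤ n := le_max_right _ _
  have hm0 : (0 : ℝ) < m := by linarith
  have hn0 : (0 : ℝ) < n := by linarith
  have hmn : |n - m| ≤ ‖x - y‖ := by
    have h := abs_max_sub_max_le_max 1 ‖y‖ 1 ‖x‖
    rw [sub_self, abs_zero, max_eq_right (abs_nonneg (‖y‖ - ‖x‖))] at h
    exact h.trans (by rw [norm_sub_rev]; exact abs_norm_sub_norm_le y x)
  have key : unitBallRetraction x - unitBallRetraction y =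
      (m : ℂ)⁻¹ • (x - y) + ((m : ℂ)⁻¹ - (n : ℂ)⁻¹) • y := by
    simp only [unitBallRetraction, ← hm, ← hn, smul_sub, sub_smul]
    abel
  have h1 : ‖(m : ℂ)⁻¹ • (x - y)‖ ≤ ‖x - y‖ := by
    rw [norm_smul, norm_inv, Complex.norm_real, Real.norm_of_nonneg hm0.le]
    exact mul_le_of_le_one_left (norm_nonneg _) (inv_le_one_of_one_le₀ hm1)
  have h2 : ‖((m : ℂ)⁻¹ - (n : ℂ)⁻¹) • y‖ ≤ ‖x - y‖ := by
    have : (m : ℂ)⁻¹ - (n : ℂ)⁻¹ = (((n - m) / (m * n) : ℝ) : ℂ) := by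
      have hm' : (m : ℂ) ≠ 0 := by exact_mod_cast hm0.ne'
      have hn' : (n : ℂ) ≠ 0 := by exact_mod_cast hn0.ne'
      push_cast
      field_simp
    rw [norm_smul, this, Complex.norm_real, Real.norm_eq_abs, abs_div,
      abs_of_pos (mul_pos hm0 hn0), div_mul_eq_mul_div, div_le_iff₀ (mul_pos hm0 hn0)]
    have := norm_nonneg (x - y)
    refine mul_le_mul hmn ?_ (norm_nonneg _) this
    nlinarith
  rw [key, two_mul]
  exact (norm_add_le _ _).trans (add_le_add h1 h2)

/-- A linear equation with continuous skew-adjoint coefficients is solvable globally. -/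
theorem exists_hasDerivWithinAt_of_skew [CompleteSpace E] {A : ℝ → E →L[ℂ] E} {T : ℝ} (hT : 0 ≤ T)
    (hA : ContinuousOn A (Icc 0 T))
    (hskew : ∀ t ∈ Icc 0 T, ∀ x, inner ℂ x (A t x) + inner ℂ (A t x) x = 0)
    {x₀ : E} (hx₀ : ‖x₀‖ ≤ 1) :
    ∃ φ : ℝ → E, φ 0 = x₀ ∧ ∀ t ∈ Icc 0 T, HasDerivWithinAt φ (A t (φ t)) (Icc 0 T) t := by
  obtain ⟨C, hC⟩ := isCompact_Icc.exists_bound_of_continuousOn hA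
  have hC0 : 0 ≤ C := (norm_nonneg _).trans (hC 0 ⟨le_rfl, hT⟩)
  lift C to ℝ≥0 using hC0
  have hC0 : (0 : ℝ) ≤ C := C.2
  -- Picard–Lindelöf needs the bound on the field times `T` to fit within the radius. Composing with
  -- the retraction bounds the field by `C` everywhere, so the radius `C * T` reaches the whole
  -- interval.
  have hPL : IsPicardLindelof (fun t x => A t (unitBallRetraction x))
      (⟨0, le_rfl, hT⟩ : Icc 0 T) x₀ (C * T.toNNReal) 0 C (C * 2) := by
    refine ⟨fun t ht => LipschitzOnWith.of_dist_le_mul fun x _ y _ => ?_, fun x _ => ?_,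
      fun t ht x _ => ?_, ?_⟩
    · rw [dist_eq_norm, dist_eq_norm, ← map_sub, NNReal.coe_mul, NNReal.coe_ofNat, mul_assoc]
      exact (ContinuousLinearMap.le_opNorm _ _).trans
        (mul_le_mul (hC t ht) (norm_unitBallRetraction_sub_le x y) (norm_nonneg _) hC0)
    · exact hA.clm_apply continuousOn_const
    · refine (ContinuousLinearMap.le_opNorm _ _).trans ?_
      simpa using mul_le_mul (hC t ht) (norm_unitBallRetraction_le x) (norm_nonneg _) hC0
    · simp [hT]
  obtain ⟨φ, h0, hφ⟩ := hPL.exists_eq_forall_mem_Icc_hasDerivWithinAt₀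
  -- The retraction is a real rescaling, so the modified field is still skew and the norm is
  -- conserved. The solution never leaves the unit ball, where the retraction is the identity.
  have hn : ∀ t ∈ Icc 0 T, ‖φ t‖ = ‖φ 0‖ := fun t ht =>
    norm_eq_of_hasDerivWithinAt_skew hφ (fun s hs => by
      have := hskew s hs (φ s)
      simp only [unitBallRetraction, map_smul, inner_smul_left, inner_smul_right, map_inv₀,
        Complex.conj_ofReal]
      rw [← mul_add, this, mul_zero]) ht
  refine ⟨φ, h0, fun t ht => ?_⟩
  have := hφ t ht
  rwa [unitBallRetraction_eq_self (by rw [hn t ht]; exact h0 ▸ hx₀)] at this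

end Evolution

/-! ### Spectral gap and adiabatic following -/

section Adiabatic

theorem MeasureTheory.IntegrableOn.clm_apply_of_continuousOn {E F : Type*} [NormedAddCommGroup E]
    [NormedSpace ℂ E] [NormedAddCommGroup F] [NormedSpace ℂ F] {A : ℝ → E →L[ℂ] F} {f : ℝ → E}
    {a b : ℝ} (hf : IntegrableOn f (Ioc a b)) (hA : ContinuousOn A (Icc a b)) :
    IntegrableOn (fun t => A t (f t)) (Ioc a b) := by
  obtain ⟨C, hC⟩ := isCompact_Icc.exists_bound_of_continuousOn hA
  refine (hf.norm.const_mul C).mono' ?_ ?_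
  · exact
      (isBoundedBilinearMap_apply (𝕜 := ℂ) (E := E) (F := F)).continuous.comp_aestronglyMeasurable
      (((hA.mono Ioc_subset_Icc_self).aestronglyMeasurable measurableSet_Ioc).prodMk
        hf.aestronglyMeasurable)
  · filter_upwards [ae_restrict_mem measurableSet_Ioc] with t ht
    exact (A t).le_of_opNorm_le (hC t (Ioc_subset_Icc_self ht)) _

variable {E : Type*} [NormedAddCommGroup E] [InnerProductSpace ℂ E]

/-- `H` shifted by the orthogonal projection onto the line of a unit vector `z`. -/
noncomputable def addProj (H : E →L[ℂ] E) (z : E) : E →L[ℂ] E :=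
  H + (innerSL ℂ z).smulRight z

theorem addProj_apply (H : E →L[ℂ] E) (z x : E) : addProj H z x = H x + inner ℂ z x • z := rfl

theorem continuousOn_addProj {H : ℝ → E →L[ℂ] E} {z : ℝ → E} {s : Set ℝ}
    (hH : ContinuousOn H s) (hz : ContinuousOn z s) :
    ContinuousOn (fun t => addProj (H t) (z t)) s := by
  unfold addProj
  refine hH.add ?_
  have h1 : ContinuousOn (fun t => innerSL ℂ (z t)) s :=
    (innerSL ℂ (E := E)).continuous.comp_continuousOn hz
  exact ((ContinuousLinearMap.smulRightL ℂ E E).continuous.comp_continuousOn h1).clm_apply hz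

/-- `z` is a unit vector spanning the kernel of the symmetric operator `H`. -/
structure IsUnitKernelVector (H : E →L[ℂ] E) (z : E) : Prop where
  symm : ∀ x y, inner ℂ (H x) y = inner ℂ x (H y)
  norm_eq_one : ‖z‖ = 1
  map_eq_zero : H z = 0
  exists_smul : ∀ x, H x = 0 → ∃ c : ℂ, x = c • z

namespace IsUnitKernelVector

variable {H : E →L[ℂ] E} {z : E}

theorem inner_self (h : IsUnitKernelVector H z) : inner ℂ z z = 1 := by
  rw [inner_self_eq_norm_sq_to_K, h.norm_eq_one]
  simp

theorem inner_apply (h : IsUnitKernelVector H z) (x : E) : inner ℂ z (H x) = 0 := by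
  rw [← h.symm, h.map_eq_zero, inner_zero_left]

theorem inner_addProj (h : IsUnitKernelVector H z) (x : E) :
    inner ℂ z (addProj H z x) = inner ℂ z x := by
  rw [addProj_apply, inner_add_right, h.inner_apply, zero_add, inner_smul_right, h.inner_self,
    mul_one]

theorem isUnit_addProj [FiniteDimensional ℂ E] (h : IsUnitKernelVector H z) :
    IsUnit (addProj H z) := by
  have hinj : Function.Injective (addProj H z) := by
    rw [injective_iff_map_eq_zero]
    intro x hx
    have h1 : inner ℂ z x = 0 := by rw [← h.inner_addProj, hx, inner_zero_right]
    have h2 : H x = 0 := by simpa [addProj_apply, h1] using hx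
    obtain ⟨c, rfl⟩ := h.exists_smul x h2
    rw [inner_smul_right, h.inner_self, mul_one] at h1
    rw [h1, zero_smul]
  have := FiniteDimensional.complete ℂ E
  rw [ContinuousLinearMap.isUnit_iff_bijective]
  exact ⟨hinj, (LinearMap.injective_iff_surjective (f := (addProj H z).toLinearMap)).1 hinj⟩

/-- The shift preserves the component along `z` and equals `H` on the complement of `z`, so its
inverse acts there as the reduced resolvent at zero. -/
theorem apply_inverse [FiniteDimensional ℂ E] (h : IsUnitKernelVector H z) {x : E}
    (hx : inner ℂ z x = 0) : H (Ring.inverse (addProj H z) x) = x := by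
  have h1 : addProj H z (Ring.inverse (addProj H z) x) = x := by
    rw [← mul_apply_eq_comp, Ring.mul_inverse_cancel _ h.isUnit_addProj]
    rfl
  have h2 : inner ℂ z (Ring.inverse (addProj H z) x) = 0 := by rw [← h.inner_addProj, h1, hx]
  rwa [addProj_apply, h2, zero_smul, add_zero] at h1

end IsUnitKernelVector

variable [FiniteDimensional ℂ E] {H : ℝ → E →L[ℂ] E} {z : ℝ → E} {T : ℝ}

theorem continuousOn_inverse_addProj (hH : ContinuousOn H (Icc 0 T)) (hz : ContinuousOn z (Icc 0 T))
    (hk : ∀ t ∈ Icc 0 T, IsUnitKernelVector (H t) (z t)) :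
    ContinuousOn (fun t => Ring.inverse (addProj (H t) (z t))) (Icc 0 T) := by
  have := FiniteDimensional.complete ℂ E
  intro t ht
  obtain ⟨u, hu⟩ := (hk t ht).isUnit_addProj
  have h := NormedRing.inverse_continuousAt u
  rw [hu] at h
  exact ContinuousAt.comp_continuousWithinAt (f := fun t => addProj (H t) (z t)) h
    (continuousOn_addProj hH hz t ht)

/-- A continuous family of symmetric operators with one-dimensional kernels has a uniform spectral
gap around zero. -/
theorem exists_gap (hH : ContinuousOn H (Icc 0 T)) (hz : ContinuousOn z (Icc 0 T))
    (hk : ∀ t ∈ Icc 0 T, IsUnitKernelVector (H t) (z t)) :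
    ∃ ε > 0, ∀ t ∈ Icc 0 T, ∀ (μ : ℂ) (x : E), H t x = μ • x → x ≠ 0 → μ ≠ 0 → ε ≤ ‖μ‖ := by
  obtain ⟨C, hC⟩ := isCompact_Icc.exists_bound_of_continuousOn
    (continuousOn_inverse_addProj hH hz hk)
  refine ⟨(|C| + 1)⁻¹, by positivity, fun t ht μ x hx hx0 hμ => ?_⟩
  have h := hk t ht
  -- Eigenvectors with `μ ≠ 0` are orthogonal to `z`, hence are also eigenvectors of the shifted
  -- operator, and the bound on its inverse bounds `μ` from below.
  have h1 : inner ℂ (z t) x = 0 := by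
    have := h.inner_apply x
    rw [hx, inner_smul_right] at this
    exact (mul_eq_zero.1 this).resolve_left hμ
  have h2 : addProj (H t) (z t) x = μ • x := by rw [addProj_apply, h1, zero_smul, add_zero, hx]
  have h3 : Ring.inverse (addProj (H t) (z t)) (μ • x) = x := by
    rw [← h2, ← mul_apply_eq_comp, Ring.inverse_mul_cancel _ h.isUnit_addProj]
    rfl
  have h4 : ‖x‖ ≤ (|C| + 1) * (‖μ‖ * ‖x‖) := by
    rw [← norm_smul]
    conv_lhs => rw [← h3]
    refine (ContinuousLinearMap.le_opNorm _ _).trans ?_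
    gcongr
    have := hC t ht
    linarith [le_abs_self C]
  have hxp : 0 < ‖x‖ := norm_pos_iff.2 hx0
  rw [inv_le_iff_one_le_mul₀ (by positivity)]
  nlinarith

/-- The velocity of the kernel vector is `L¹`-close to `H y` for a smooth `y`. -/
theorem exists_contDiff_integral_norm_sub_le (hT : 0 ≤ T) (hH : ContinuousOn H (Icc 0 T))
    (hz : AbsolutelyContinuousOnInterval z 0 T)
    (hk : ∀ t ∈ Icc 0 T, IsUnitKernelVector (H t) (z t))
    (hpar : ∀ᵐ t, t ∈ Icc 0 T → inner ℂ (z t) (deriv z t) = 0) {η : ℝ} (hη : 0 < η) :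
    ∃ y : ℝ → E, ContDiff ℝ ∞ y ∧ ∫ t in 0..T, ‖deriv z t - H t (y t)‖ ≤ η := by
  have : FiniteDimensional ℝ E := FiniteDimensional.complexToReal E
  have hzc : ContinuousOn z (Icc 0 T) := by simpa [uIcc_of_le hT] using hz.continuousOn
  obtain ⟨C, hC⟩ := isCompact_Icc.exists_bound_of_continuousOn hH
  have hC0 : 0 ≤ C := (norm_nonneg _).trans (hC 0 ⟨le_rfl, hT⟩)
  set R := fun t => Ring.inverse (addProj (H t) (z t)) with hR
  have hRc : ContinuousOn R (Icc 0 T) := continuousOn_inverse_addProj hH hzc hk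
  have hz' := hz.intervalIntegrable_deriv_of_finiteDimensional
  have hRz : IntervalIntegrable (fun t => R t (deriv z t)) volume 0 T := by
    rw [intervalIntegrable_iff_integrableOn_Ioc_of_le hT] at hz' ⊢
    exact hz'.clm_apply_of_continuousOn hRc
  have hint : Integrable ((Ioc 0 T).indicator fun t => R t (deriv z t)) := by
    rw [integrable_indicator_iff measurableSet_Ioc]
    exact (intervalIntegrable_iff_integrableOn_Ioc_of_le hT).1 hRz
  -- The exact solution `R z'` of `H y = z'` is only integrable; smooth compactly supported
  -- functions are dense in `L¹`. Applying `H` costs a factor `C`, and `C + 1` avoids division by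
  -- zero.
  obtain ⟨y, hyc, hy, hle⟩ := (memLp_one_iff_integrable.2 hint).exist_eLpNorm_sub_le
    ENNReal.one_ne_top le_rfl (ε := η / (C + 1)) (by positivity)
  refine ⟨y, hy, ?_⟩
  have hd := hint.sub (hy.continuous.integrable_of_hasCompactSupport hyc)
  have hle' : ∫ t, ‖((Ioc 0 T).indicator (fun t => R t (deriv z t)) - y) t‖ ≤ η / (C + 1) := by
    rw [integral_norm_eq_lintegral_enorm hd.aestronglyMeasurable]
    rw [eLpNorm_one_eq_lintegral_enorm] at hle
    exact ENNReal.toReal_le_of_le_ofReal (by positivity) hle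
  rw [intervalIntegral.integral_of_le hT]
  calc ∫ t in Ioc 0 T, ‖deriv z t - H t (y t)‖
      ≤ ∫ t in Ioc 0 T, C * ‖((Ioc 0 T).indicator (fun t => R t (deriv z t)) - y) t‖ := by
        refine integral_mono_of_nonneg (Eventually.of_forall fun t => norm_nonneg _)
          (hd.norm.const_mul C).integrableOn ?_
        rw [EventuallyLE, ae_restrict_iff' measurableSet_Ioc]
        filter_upwards [hpar] with t ht ht'
        have htI := Ioc_subset_Icc_self ht'
        have h1 := (hk t htI).apply_inverse (ht htI)
        rw [Pi.sub_apply, indicator_of_mem ht']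
        conv_lhs => rw [← h1, ← map_sub]
        exact (H t).le_of_opNorm_le (hC t htI) _
    _ ≤ ∫ t, C * ‖((Ioc 0 T).indicator (fun t => R t (deriv z t)) - y) t‖ :=
        setIntegral_le_integral (hd.norm.const_mul C)
          (Eventually.of_forall fun t => mul_nonneg hC0 (norm_nonneg _))
    _ ≤ C * (η / (C + 1)) := by
        rw [integral_const_mul]
        exact mul_le_mul_of_nonneg_left hle' hC0
    _ ≤ η := by
        rw [mul_div_assoc', div_le_iff₀ (by positivity)]
        nlinarith

/-- **Adiabatic theorem** for an isolated nondegenerate zero eigenvalue and an absolutely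
continuous, parallel transported eigenvector. -/
theorem adiabatic_following (hT : 0 ≤ T) (hH : ContinuousOn H (Icc 0 T))
    (hz : AbsolutelyContinuousOnInterval z 0 T)
    (hk : ∀ t ∈ Icc 0 T, IsUnitKernelVector (H t) (z t))
    (hpar : ∀ᵐ t, t ∈ Icc 0 T → inner ℂ (z t) (deriv z t) = 0) {δ : ℝ} (hδ : 0 < δ) :
    ∃ l₀ > 0, ∀ l : ℝ, l₀ ≤ l → ∀ φ : ℝ → E, φ 0 = z 0 →
      (∀ t ∈ Icc 0 T, HasDerivWithinAt φ ((-(Complex.I * l)) • H t (φ t)) (Icc 0 T) t) →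
      ∀ t ∈ Icc 0 T, ‖φ t - z t‖ ≤ δ := by
  have : FiniteDimensional ℝ E := FiniteDimensional.complexToReal E
  -- Since `‖φ - z‖² = 2 - 2 Re ⟪z, φ⟫`, an overlap error of `δ²/2` suffices: half for this
  -- approximation, half for the terms of order `1/l`.
  obtain ⟨y, hy, hyη⟩ := exists_contDiff_integral_norm_sub_le hT hH hz hk hpar
    (η := δ ^ 2 / 4) (by positivity)
  have hy' : Continuous (deriv y) := hy.continuous_deriv (by simp)
  obtain ⟨D, hD⟩ := (isCompact_Icc (a := (0 : ℝ)) (b := T)).exists_bound_of_continuousOn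
    hy.continuous.continuousOn
  obtain ⟨D', hD'⟩ := (isCompact_Icc (a := (0 : ℝ)) (b := T)).exists_bound_of_continuousOn
    hy'.continuousOn
  have h0 : (0 : ℝ) ∈ Icc 0 T := ⟨le_rfl, hT⟩
  have hD0 : 0 ≤ D := (norm_nonneg _).trans (hD 0 h0)
  have hD'0 : 0 ≤ D' := (norm_nonneg _).trans (hD' 0 h0)
  have herr : IntervalIntegrable (fun t => ‖deriv z t - H t (y t)‖) volume 0 T := by
    refine (hz.intervalIntegrable_deriv_of_finiteDimensional.sub ?_).norm
    refine ContinuousOn.intervalIntegrable ?_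
    rw [uIcc_of_le hT]
    exact hH.clm_apply hy.continuous.continuousOn
  refine ⟨4 * (T * D' + 2 * D) / δ ^ 2 + 1, by positivity, fun l hl φ hφ0 hφ t ht => ?_⟩
  have hl0 : 0 < l := lt_of_lt_of_le (by positivity) hl
  have hlC : (l : ℂ) ≠ 0 := by exact_mod_cast hl0.ne'
  have hlK : (T * D' + 2 * D) / l ≤ δ ^ 2 / 4 := by
    rw [div_le_iff₀ hl0]
    have h1 : 4 * (T * D' + 2 * D) / δ ^ 2 ≤ l := by linarith
    rw [div_le_iff₀ (by positivity)] at h1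
    linarith
  have hφn : ∀ s ∈ Icc 0 T, ‖φ s‖ = 1 := by
    intro s hs
    rw [norm_eq_of_hasDerivWithinAt_skew hφ (fun r hr => ?_) hs, hφ0, (hk 0 h0).norm_eq_one]
    rw [inner_smul_left, inner_smul_right, (hk r hr).symm]
    simp
  have hφac : AbsolutelyContinuousOnInterval φ 0 T := by
    have hφc : ContinuousOn φ (Icc 0 T) := fun s hs => (hφ s hs).continuousWithinAt
    obtain ⟨C, hC⟩ := isCompact_Icc.exists_bound_of_continuousOn
      (continuousOn_const.smul (hH.clm_apply hφc) :
        ContinuousOn (fun s => (-(Complex.I * l)) • H s (φ s)) (Icc 0 T))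
    have hC0 : 0 ≤ C := (norm_nonneg _).trans (hC 0 h0)
    lift C to ℝ≥0 using hC0
    refine LipschitzOnWith.absolutelyContinuousOnInterval (K := C) ?_
    rw [uIcc_of_le hT]
    exact (convex_Icc 0 T).lipschitzOnWith_of_nnnorm_hasDerivWithin_le hφ hC
  -- The correction is chosen so that `(i/l) ⟪y, φ'⟫ = ⟪H y, φ⟫`, which nearly cancels `⟪z', φ⟫`;
  -- the term `⟪z, φ'⟫` vanishes because `H z = 0`.
  set G : ℝ → ℂ := fun s => inner ℂ (z s) (φ s) - (Complex.I / l) * inner ℂ (y s) (φ s) with hG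
  have hGac : AbsolutelyContinuousOnInterval G 0 T := by
    have hyac : AbsolutelyContinuousOnInterval y 0 T :=
      ((hy.of_le (by simp)).contDiffOn (n := 1)).absolutelyContinuousOnInterval
    exact (hz.inner_complex hφac).sub ((hyac.inner_complex hφac).const_smul (Complex.I / (l : ℂ)))
  -- At the endpoints `φ` has only a one-sided derivative; they form a null set.
  have hGd : ∀ᵐ s, s ∈ Icc 0 T → s ≠ 0 → s ≠ T →
      ‖deriv G s‖ ≤ ‖deriv z s - H s (y s)‖ + D' / l := by
    filter_upwards [hz.ae_hasDerivAt] with s hs hsI hs0 hsT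
    have hzs := hs (by rwa [uIcc_of_le hT])
    have hφs := (hφ s hsI).hasDerivAt
      (Icc_mem_nhds (lt_of_le_of_ne hsI.1 (Ne.symm hs0)) (lt_of_le_of_ne hsI.2 hsT))
    have hys : HasDerivAt y (deriv y s) s := (hy.differentiable (by simp) s).hasDerivAt
    have hGs := (hzs.inner ℂ hφs).sub ((hys.inner ℂ hφs).const_mul (Complex.I / l))
    have heq : deriv G s = inner ℂ (deriv z s - H s (y s)) (φ s) -
        (Complex.I / l) * inner ℂ (deriv y s) (φ s) := by
      refine hGs.deriv.trans ?_
      rw [inner_smul_right, inner_smul_right, (hk s hsI).inner_apply, inner_sub_left,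
        (hk s hsI).symm]
      field_simp
      ring_nf
      rw [Complex.I_sq]
      ring
    rw [heq]
    refine (norm_sub_le _ _).trans (add_le_add ?_ ?_)
    · refine (norm_inner_le_norm _ _).trans ?_
      rw [hφn s hsI, mul_one]
    · rw [norm_mul, norm_div, Complex.norm_I, Complex.norm_real, Real.norm_of_nonneg hl0.le,
        div_mul_eq_mul_div, one_mul]
      gcongr
      refine (norm_inner_le_norm _ _).trans ?_
      rw [hφn s hsI, mul_one]
      exact hD' s hsI
  have hsub : uIcc 0 t ⊆ uIcc 0 T := by
    rw [uIcc_of_le ht.1, uIcc_of_le hT]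
    exact Icc_subset_Icc_right ht.2
  have hGt : ‖G t - G 0‖ ≤ δ ^ 2 / 4 + T * D' / l := by
    have hBT := herr.add (intervalIntegrable_const (c := D' / l))
    refine ((hGac.mono hsub).norm_sub_le_integral ht.1 (hBT.mono_set hsub) ?_).trans ?_
    · have e0 : ∀ᵐ s : ℝ, s ≠ 0 := by simp [ae_iff, measure_singleton]
      have eT : ∀ᵐ s : ℝ, s ≠ T := by simp [ae_iff, measure_singleton]
      filter_upwards [hGd, e0, eT] with s h1 h2 h3 hs
      exact h1 (by have := hsub hs; rwa [uIcc_of_le hT] at this) h2 h3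
    · refine (intervalIntegral.integral_mono_interval le_rfl ht.1 ht.2 ?_ hBT).trans ?_
      · exact Eventually.of_forall fun s => add_nonneg (norm_nonneg _) (by positivity)
      · rw [intervalIntegral.integral_add herr intervalIntegrable_const,
          intervalIntegral.integral_const, smul_eq_mul, sub_zero, mul_div_assoc]
        linarith
  have hyφ : ∀ s ∈ Icc 0 T, ‖(Complex.I / l) * inner ℂ (y s) (φ s)‖ ≤ D / l := by
    intro s hs
    rw [norm_mul, norm_div, Complex.norm_I, Complex.norm_real, Real.norm_of_nonneg hl0.le,
      div_mul_eq_mul_div, one_mul]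
    gcongr
    refine (norm_inner_le_norm _ _).trans ?_
    rw [hφn s hs, mul_one]
    exact hD s hs
  have hin : ‖inner ℂ (z t) (φ t) - 1‖ ≤ δ ^ 2 / 2 := by
    have e : inner ℂ (z t) (φ t) - 1 = (G t - G 0) + (Complex.I / l) * inner ℂ (y t) (φ t)
        - (Complex.I / l) * inner ℂ (y 0) (φ 0) := by
      have : inner ℂ (z 0) (φ 0) = 1 := by rw [hφ0, (hk 0 h0).inner_self]
      simp only [hG, this]
      ring
    rw [e]
    refine (norm_sub_le _ _).trans ((add_le_add (norm_add_le _ _) le_rfl).trans ?_)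
    have h1 := hyφ t ht
    have h2 := hyφ 0 h0
    have h3 : (T * D' + 2 * D) / l = T * D' / l + D / l + D / l := by ring
    linarith
  have hsq : ‖φ t - z t‖ ^ 2 ≤ δ ^ 2 := by
    rw [@norm_sub_sq ℂ, hφn t ht, (hk t ht).norm_eq_one, inner_re_symm]
    have h1 := (Complex.abs_re_le_norm _).trans hin
    rw [Complex.sub_re, Complex.one_re] at h1
    have h2 := (abs_le.1 h1).1
    simp only [RCLike.re_eq_complex_re]
    linarith
  exact le_of_sq_le_sq hsq hδ.le

/-- An absolutely continuous path of nonzero vectors can be rescaled to a parallel transported path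
of unit vectors. -/
theorem exists_parallel_transport {ζ : ℝ → E} (hT : 0 ≤ T)
    (hζ : AbsolutelyContinuousOnInterval ζ 0 T) (hne : ∀ t ∈ Icc 0 T, ζ t ≠ 0) (h0 : ‖ζ 0‖ = 1) :
    ∃ c : ℝ → ℂ, c 0 = 1 ∧ AbsolutelyContinuousOnInterval (fun t => c t • ζ t) 0 T ∧
      (∀ t ∈ Icc 0 T, ‖c t • ζ t‖ = 1) ∧
      ∀ᵐ t, t ∈ Icc 0 T → inner ℂ (c t • ζ t) (deriv (fun t => c t • ζ t) t) = 0 := by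
  have : FiniteDimensional ℝ E := FiniteDimensional.complexToReal E
  have hζc : ContinuousOn ζ (Icc 0 T) := by simpa [uIcc_of_le hT] using hζ.continuousOn
  have h0I : (0 : ℝ) ∈ Icc 0 T := ⟨le_rfl, hT⟩
  have hne' : ∀ t ∈ Icc 0 T, inner ℂ (ζ t) (ζ t) ≠ 0 := fun t ht =>
    inner_self_ne_zero.2 (hne t ht)
  -- For `c = exp (∫ k)`, the equation `c' = k c` says exactly that `c • ζ` has velocity orthogonal
  -- to itself.
  set k : ℝ → ℂ := fun t => -((inner ℂ (ζ t) (ζ t))⁻¹ * inner ℂ (ζ t) (deriv ζ t)) with hk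
  have hkint : IntervalIntegrable k volume 0 T := by
    have hd := hζ.intervalIntegrable_deriv_of_finiteDimensional
    rw [intervalIntegrable_iff_integrableOn_Ioc_of_le hT] at hd ⊢
    have hc : ContinuousOn (fun t => -((inner ℂ (ζ t) (ζ t))⁻¹ • innerSL ℂ (ζ t))) (Icc 0 T) :=
      (((hζc.inner hζc).inv₀ hne').smul
        ((innerSL ℂ (E := E)).continuous.comp_continuousOn hζc)).neg
    exact hd.clm_apply_of_continuousOn hc
  set p : ℝ → ℂ := fun t => ∫ s in 0..t, k s with hp
  have hpac : AbsolutelyContinuousOnInterval p 0 T := hkint.absolutelyContinuousOnInterval_integral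
  have hcac : AbsolutelyContinuousOnInterval (fun t => Complex.exp (p t)) 0 T :=
    hpac.contDiff_comp Complex.contDiff_exp
  have hzac : AbsolutelyContinuousOnInterval (fun t => Complex.exp (p t) • ζ t) 0 T :=
    hcac.smul hζ
  have hpar : ∀ᵐ t, t ∈ Icc 0 T → inner ℂ (Complex.exp (p t) • ζ t)
      (deriv (fun t => Complex.exp (p t) • ζ t) t) = 0 := by
    filter_upwards [hζ.ae_hasDerivAt, hkint.ae_hasDerivAt_integral] with t h1 h2 ht
    have htu : t ∈ uIcc 0 T := by rwa [uIcc_of_le hT]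
    have hd := (h2 htu 0 left_mem_uIcc).cexp.smul (h1 htu)
    have hn := hne' t ht
    have e : deriv (fun t => Complex.exp (p t) • ζ t) t = _ := hd.deriv
    rw [e, inner_smul_left, inner_add_right, inner_smul_right, inner_smul_right]
    simp only [hk]
    field_simp
    ring
  refine ⟨fun t => Complex.exp (p t), by simp [hp], hzac, fun t ht => ?_, hpar⟩
  have hnac := hzac.inner_complex hzac
  have hsub : uIcc 0 T ⊆ Icc 0 T := (uIcc_of_le hT).subset
  -- Orthogonality to the velocity also makes the norm constant, so the factor `c` normalizes as
  -- well as fixing the phase.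
  obtain ⟨C, hC⟩ := hnac.const_of_ae_hasDerivAt_zero (by
    filter_upwards [hpar, hzac.ae_hasDerivAt] with t h1 h2 ht
    have h3 := h1 (hsub ht)
    have h4 := (h2 ht).inner ℂ (h2 ht)
    rw [h3, ← inner_conj_symm, h3, map_zero, add_zero] at h4
    exact h4)
  have ht' := hC t (by rwa [uIcc_of_le hT])
  rw [← hC 0 left_mem_uIcc, inner_self_eq_norm_sq_to_K, inner_self_eq_norm_sq_to_K] at ht'
  have h3 : ‖Complex.exp (p t) • ζ t‖ ^ 2 = ‖Complex.exp (p 0) • ζ 0‖ ^ 2 := by exact_mod_cast ht'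
  rw [(pow_left_inj₀ (norm_nonneg _) (norm_nonneg _) two_ne_zero).1 h3]
  simp [hp, h0]

end Adiabatic

/-! ### The block of weights between the two parts -/

theorem mem_zeroSpace_iff {V : Type*} [Fintype V] [DecidableEq V] {A : Matrix V V ℂ}
    {x : EuclideanSpace ℂ V} : x ∈ zeroSpace A ↔ ∀ u, ∑ v, A u v * x v = 0 := by
  rw [zeroSpace, LinearMap.mem_ker]
  constructor
  · intro h u
    exact congrArg (fun y : EuclideanSpace ℂ V => y u) h
  · intro h
    ext u
    exact h u

namespace WeightedGraph

section Block

variable {V : Type*} [DecidableEq V] {V₁ V₂ : Finset V}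

theorem exists_ne_zero_sum_eq_zero (G : WeightedGraph V) (hcard : V₁.card = V₂.card + 1) :
    ∃ x : V → ℂ, (∃ v ∈ V₁, x v ≠ 0) ∧ (∀ v ∉ V₁, x v = 0) ∧
      ∀ u ∈ V₂, ∑ v ∈ V₁, G.weight u v * x v = 0 := by
  let M : Matrix V₂ V₁ ℂ := Matrix.of fun u v => G.weight u v
  obtain ⟨y, hy, hy0⟩ := (Submodule.ne_bot_iff _).1 (LinearMap.ker_ne_bot_of_finrank_lt
    (f := M.mulVecLin) (by simp [hcard]))
  obtain ⟨v, hv⟩ := Function.ne_iff.1 hy0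
  refine ⟨fun v => if h : v ∈ V₁ then y ⟨v, h⟩ else 0, ⟨v, v.2, by simpa using hv⟩,
    fun v hv => dif_neg hv, fun u hu => ?_⟩
  rw [← Finset.sum_coe_sort]
  have := congrFun (LinearMap.mem_ker.1 hy) ⟨u, hu⟩
  simpa [M, Matrix.mulVec, dotProduct] using this

/-- If the block of weights from `V₁` to `V₂` has a kernel of dimension one, its adjoint is
injective. -/
theorem eq_zero_of_sum_eq_zero (G : WeightedGraph V) (hcard : V₁.card = V₂.card + 1)
    {x : V → ℂ} (hx0 : ∀ u ∈ V₂, ∑ v ∈ V₁, G.weight u v * x v = 0)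
    (hx : ∀ y : V → ℂ, (∀ u ∈ V₂, ∑ v ∈ V₁, G.weight u v * y v = 0) →
      ∃ c : ℂ, ∀ v ∈ V₁, y v = c * x v) {y : V → ℂ}
    (hy : ∀ v ∈ V₁, ∑ u ∈ V₂, G.weight v u * y u = 0) : ∀ u ∈ V₂, y u = 0 := by
  let M : Matrix V₂ V₁ ℂ := Matrix.of fun u v => G.weight u v
  have hker : Module.finrank ℂ (LinearMap.ker M.mulVecLin) ≤ 1 := by
    refine finrank_le_one ⟨fun v => x v, ?_⟩ ?_
    · rw [LinearMap.mem_ker]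
      ext u
      rw [Matrix.mulVecLin_apply, Pi.zero_apply, ← hx0 u u.2, ← Finset.sum_coe_sort V₁]
      rfl
    · rintro ⟨w, hw⟩
      obtain ⟨c, hc⟩ := hx (fun v => if h : v ∈ V₁ then w ⟨v, h⟩ else 0) fun u hu => by
        rw [← Finset.sum_coe_sort V₁]
        have := congrFun (LinearMap.mem_ker.1 hw) ⟨u, hu⟩
        simpa [M, Matrix.mulVec, dotProduct] using this
      refine ⟨c, Subtype.ext (funext fun v => ?_)⟩
      have := hc v v.2
      simp only [Finset.coe_mem, dite_true] at this
      exact this.symm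
  -- Rank–nullity: the rank is at least `|V₁| - 1 = |V₂|`. Writing `y = M x'` then gives `‖y‖² = ⟪M*
  -- y, x'⟫ = 0`.
  have hsurj : Function.Surjective M.mulVecLin := by
    rw [← LinearMap.range_eq_top]
    refine Submodule.eq_top_of_finrank_eq ?_
    have h1 := M.mulVecLin.finrank_range_add_finrank_ker
    have h2 := Submodule.finrank_le (LinearMap.range M.mulVecLin)
    simp only [Module.finrank_fintype_fun_eq_card, Fintype.card_coe] at h1 h2 ⊢
    omega
  obtain ⟨x', hx'⟩ := hsurj fun u => y u
  have h0 : ∑ u : V₂, star (y u) * y u = 0 := by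
    have h1 : ∀ u : V₂, star (y u) * y u = ∑ v : V₁, star (G.weight v u * y u) * x' v := by
      intro u
      have : y u = ∑ v, M u v * x' v := (congrFun hx' u).symm
      nth_rewrite 2 [this]
      rw [Finset.mul_sum]
      refine Finset.sum_congr rfl fun v _ => ?_
      rw [star_mul', ← G.weight_conj]
      simp only [M, Matrix.of_apply]
      ring
    rw [Finset.sum_congr rfl fun u _ => h1 u, Finset.sum_comm]
    refine Finset.sum_eq_zero fun v _ => ?_
    rw [← Finset.sum_mul, ← star_sum, Finset.sum_coe_sort V₂ (fun u => G.weight v u * y u),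
      hy v v.2, star_zero, zero_mul]
  intro u hu
  have h2 : ∑ u : V₂, ‖y u‖ ^ 2 = 0 := by
    have : ∀ u : V₂, star (y u) * y u = ((‖y u‖ ^ 2 : ℝ) : ℂ) := fun u => by
      rw [Complex.star_def, Complex.conj_mul']
      push_cast
      rfl
    rw [Finset.sum_congr rfl fun u _ => this u] at h0
    exact_mod_cast h0
  have h3 := (Finset.sum_eq_zero_iff_of_nonneg fun _ _ => by positivity).1 h2 ⟨u, hu⟩
    (Finset.mem_univ _)
  simpa using h3

end Block

variable {V : Type*} [Fintype V] [DecidableEq V] {G : WeightedGraph V} {V₁ V₂ P : Finset V}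

/-- `x` spans the kernel of the block of weights from `V₁` to `V₂`, the adjoint of this block is
injective, and `x` does not vanish on `P`. -/
structure IsKernelAmplitude (G : WeightedGraph V) (V₁ V₂ P : Finset V) (x : V → ℂ) : Prop where
  eq_zero : ∀ v ∉ V₁, x v = 0
  exists_ne_zero : ∃ v ∈ V₁, x v ≠ 0
  sum_eq_zero : ∀ u ∈ V₂, ∑ v ∈ V₁, G.weight u v * x v = 0
  exists_smul : ∀ y : V → ℂ, (∀ u ∈ V₂, ∑ v ∈ V₁, G.weight u v * y v = 0) →
    ∃ c : ℂ, ∀ v ∈ V₁, y v = c * x v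
  ne_zero : ∀ p ∈ P, x p ≠ 0
  injective : ∀ y : V → ℂ, (∀ v ∈ V₁, ∑ u ∈ V₂, G.weight v u * y u = 0) → ∀ u ∈ V₂, y u = 0

theorem IsSemiBipartite.mem_right (hsemi : G.IsSemiBipartite V₁ V₂) {v : V} (hv : v ∉ V₁) :
    v ∈ V₂ := by
  have := hsemi.isCompl.sup_eq_top
  have h : v ∈ V₁ ⊔ V₂ := this ▸ Finset.mem_univ v
  exact (Finset.mem_union.1 h).resolve_left hv

theorem IsSemiBipartite.notMem_left (hsemi : G.IsSemiBipartite V₁ V₂) {v : V} (hv : v ∈ V₂) :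
    v ∉ V₁ := fun h => Finset.disjoint_left.1 hsemi.isCompl.disjoint h hv

theorem IsSemiBipartite.sum_univ (hsemi : G.IsSemiBipartite V₁ V₂) (F : V → ℂ) :
    ∑ v, F v = ∑ v ∈ V₁, F v + ∑ v ∈ V₂, F v := by
  rw [← Finset.sum_union hsemi.isCompl.disjoint]
  congr 1
  exact hsemi.isCompl.sup_eq_top.symm

theorem IsSemiBipartite.weight_eq_zero (hsemi : G.IsSemiBipartite V₁ V₂) {u v : V} (hu : u ∈ V₁)
    (hv : v ∈ V₁) : G.weight u v = 0 :=
  G.weight_eq_zero u v (hsemi.not_adj u hu v hv)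

theorem IsSemiBipartite.sum_weight_mul_eq_zero (hsemi : G.IsSemiBipartite V₁ V₂) {y : V → ℂ}
    (hy : ∀ v ∉ V₁, y v = 0) (h : ∀ u ∈ V₂, ∑ v ∈ V₁, G.weight u v * y v = 0) (u : V) :
    ∑ v, G.weight u v * y v = 0 := by
  rw [hsemi.sum_univ, Finset.sum_eq_zero (s := V₂) fun v hv => by
    rw [hy v (hsemi.notMem_left hv), mul_zero], add_zero]
  by_cases hu : u ∈ V₁
  · exact Finset.sum_eq_zero fun v hv => by rw [hsemi.weight_eq_zero hu hv, zero_mul]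
  · exact h u (hsemi.mem_right hu)

theorem exists_isKernelAmplitude (hsemi : G.IsSemiBipartite V₁ V₂)
    (hPne : P.Nonempty) (hcard : V₁.card = V₂.card + 1)
    (h : (∀ p ∈ P, (G.deleteVertex p).adjMatrix.det ≠ 0) ∨
      (HasUniqueZeroEigenvector G.adjMatrix ∧
        ∀ x ∈ zeroSpace G.adjMatrix, x ≠ 0 → ∀ p ∈ P, x p ≠ 0)) :
    ∃ x, IsKernelAmplitude G V₁ V₂ P x := by
  obtain ⟨x, ⟨v, hv, hxv⟩, hxV, hx⟩ := G.exists_ne_zero_sum_eq_zero hcard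
  suffices H : (∀ p ∈ P, x p ≠ 0) ∧ ∀ y : V → ℂ, (∀ v ∉ V₁, y v = 0) →
      (∀ u ∈ V₂, ∑ v ∈ V₁, G.weight u v * y v = 0) → ∃ c : ℂ, ∀ v, y v = c * x v by
    have hex : ∀ y : V → ℂ, (∀ u ∈ V₂, ∑ v ∈ V₁, G.weight u v * y v = 0) →
        ∃ c : ℂ, ∀ v ∈ V₁, y v = c * x v := by
      intro y hy
      obtain ⟨c, hc⟩ := H.2 (fun v => if v ∈ V₁ then y v else 0) (fun v hv => if_neg hv)
        fun u hu => by
          rw [← hy u hu]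
          exact Finset.sum_congr rfl fun v hv => by rw [if_pos hv]
      exact ⟨c, fun v hv => by rw [← hc v, if_pos hv]⟩
    exact ⟨x, hxV, ⟨v, hv, hxv⟩, hx, hex, H.1, fun y hy =>
      G.eq_zero_of_sum_eq_zero hcard hx hex hy⟩
  rcases h with h | ⟨h1, h2⟩
  -- A block kernel vector vanishing at `p` restricts to a kernel vector of `A_{G-p}`, so it is
  -- zero. Hence `x p ≠ 0`, and any other kernel vector minus the multiple of `x` matching it at `p`
  -- vanishes.
  · have key : ∀ p ∈ P, ∀ y : V → ℂ, (∀ v ∉ V₁, y v = 0) →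
        (∀ u ∈ V₂, ∑ v ∈ V₁, G.weight u v * y v = 0) → y p = 0 → ∀ v, y v = 0 := by
      intro p hp y hyV hy hyp v
      have h0 : (G.deleteVertex p).adjMatrix.mulVec (fun v => y v) = 0 := by
        ext u
        have := hsemi.sum_weight_mul_eq_zero hyV hy u
        rw [Fintype.sum_eq_add_sum_subtype_ne _ p, hyp, mul_zero, zero_add] at this
        exact this
      by_cases hvp : v = p
      · rw [hvp, hyp]
      · exact congrFun (Matrix.eq_zero_of_mulVec_eq_zero (h p hp) h0) ⟨v, hvp⟩
    have hne : ∀ p ∈ P, x p ≠ 0 := fun p hp h0 => hxv (key p hp x hxV hx h0 v)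
    refine ⟨hne, fun y hyV hy => ?_⟩
    obtain ⟨p, hp⟩ := hPne
    refine ⟨y p / x p, fun v => sub_eq_zero.1 (key p hp (fun v => y v - y p / x p * x v)
      (fun v hv => by simp [hyV v hv, hxV v hv]) (fun u hu => ?_) ?_ v)⟩
    · have e : ∀ v, G.weight u v * (y v - y p / x p * x v) =
          G.weight u v * y v - y p / x p * (G.weight u v * x v) := fun v => by ring
      simp only [e, Finset.sum_sub_distrib, ← Finset.mul_sum, hy u hu, hx u hu, mul_zero, sub_zero]
    · have := hne p hp
      field_simp
      ring
  -- Extended by zero, block kernel vectors are zero eigenvectors of `A_G`, so the second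
  -- alternative applies directly.
  · have hmem : ∀ y : V → ℂ, (∀ v ∉ V₁, y v = 0) →
        (∀ u ∈ V₂, ∑ v ∈ V₁, G.weight u v * y v = 0) →
        WithLp.toLp 2 y ∈ zeroSpace G.adjMatrix := fun y hyV hy =>
      mem_zeroSpace_iff.2 (hsemi.sum_weight_mul_eq_zero hyV hy)
    have hx0 : (WithLp.toLp 2 x : EuclideanSpace ℂ V) ≠ 0 := fun h0 =>
      hxv (congrArg (fun y : EuclideanSpace ℂ V => y v) h0)
    refine ⟨h2 _ (hmem x hxV hx) hx0, fun y hyV hy => ?_⟩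
    obtain ⟨c, hc⟩ := (finrank_eq_one_iff_of_nonzero' (⟨_, hmem x hxV hx⟩ : zeroSpace G.adjMatrix)
      (fun h0 => hx0 (congrArg Subtype.val h0))).1 h1 ⟨_, hmem y hyV hy⟩
    exact ⟨c, fun v => (congrArg (fun y : zeroSpace G.adjMatrix =>
      (y : EuclideanSpace ℂ V) v) hc).symm⟩

end WeightedGraph

/-! ### Zero eigenvectors of scaled Hamiltonians -/

section Kernel

variable {V : Type*} [DecidableEq V] {G : WeightedGraph V} {V₁ V₂ P : Finset V}

/-- The unnormalized zero eigenvector for the controls `d`. -/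
noncomputable def kernelVector (V₁ : Finset V) (x d : V → ℂ) : EuclideanSpace ℂ V :=
  WithLp.toLp 2 fun v => x v * ∏ u ∈ V₁.erase v, star (d u)

theorem kernelVector_apply (x d : V → ℂ) (v : V) :
    kernelVector V₁ x d v = x v * ∏ u ∈ V₁.erase v, star (d u) := rfl

theorem kernelVector_congr (x : V → ℂ) {d d' : V → ℂ} (h : ∀ v ∈ V₁, d v = d' v) :
    kernelVector V₁ x d = kernelVector V₁ x d' := by
  ext v
  rw [kernelVector_apply, kernelVector_apply]
  congr 1
  exact Finset.prod_congr rfl fun u hu => by rw [h u (Finset.mem_of_mem_erase hu)]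

/-- Controls are regular only on `V₁`; replacing the others by zero allows regularity arguments in
all of `d`. -/
theorem kernelVector_ite (x d : V → ℂ) :
    kernelVector V₁ x (fun v => if v ∈ V₁ then d v else 0) = kernelVector V₁ x d :=
  kernelVector_congr x fun v hv => by rw [if_pos hv]

theorem kernelVector_eq_single {x d : V → ℂ} {p : V} (hp : p ∈ V₁)
    (hd : d p = 0) : kernelVector V₁ x d =
      (x p * ∏ u ∈ V₁.erase p, star (d u)) • EuclideanSpace.single p 1 := by
  ext v
  rw [kernelVector_apply, PiLp.smul_apply, PiLp.single_apply]
  split_ifs with hv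
  · rw [hv, smul_eq_mul, mul_one]
  · rw [smul_zero]
    rw [Finset.prod_eq_zero (Finset.mem_erase.2 ⟨Ne.symm hv, hp⟩) (by rw [hd, star_zero]), mul_zero]

/-- `H` arises from the weights by scaling the couplings of `v ∈ V₁` with `d v`, where `d` vanishes
at most once in `V₁`, and only on `P`. -/
structure IsScaledHamiltonian (G : WeightedGraph V) (V₁ V₂ P : Finset V) (d : V → ℂ)
    (H : Matrix V V ℂ) : Prop where
  left : ∀ v ∈ V₁, ∀ u ∈ V₂, H v u = d v * G.weight v u
  right : ∀ v ∈ V₁, ∀ u ∈ V₂, H u v = star (d v) * G.weight u v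
  within : ∀ u ∈ V₁, ∀ v ∈ V₁, H u v = 0
  mem : ∀ v ∈ V₁, d v = 0 → v ∈ P
  unique : ∀ u ∈ V₁, ∀ v ∈ V₁, d u = 0 → d v = 0 → u = v

namespace IsScaledHamiltonian

variable {d x : V → ℂ} {H : Matrix V V ℂ}

theorem prod_erase_ne_zero (h : IsScaledHamiltonian G V₁ V₂ P d H) {p : V} (hp : p ∈ V₁)
    (hd : d p = 0) : ∏ u ∈ V₁.erase p, star (d u) ≠ 0 := by
  refine Finset.prod_ne_zero_iff.2 fun u hu h0 => ?_
  rw [Finset.mem_erase] at hu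
  exact hu.1 (h.unique u hu.2 p hp (star_eq_zero.1 h0) hd)

theorem kernelVector_ne_zero (h : IsScaledHamiltonian G V₁ V₂ P d H)
    (hx : G.IsKernelAmplitude V₁ V₂ P x) : kernelVector V₁ x d ≠ 0 := by
  intro h0
  have h0' : ∀ v, x v * ∏ u ∈ V₁.erase v, star (d u) = 0 := fun v =>
    congrArg (fun y : EuclideanSpace ℂ V => y v) h0
  by_cases hz : ∃ p ∈ V₁, d p = 0
  · obtain ⟨p, hp, hd⟩ := hz
    exact mul_ne_zero (hx.ne_zero p (h.mem p hp hd)) (h.prod_erase_ne_zero hp hd) (h0' p)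
  · push Not at hz
    obtain ⟨v, hv, hxv⟩ := hx.exists_ne_zero
    refine mul_ne_zero hxv (Finset.prod_ne_zero_iff.2 fun u hu => ?_) (h0' v)
    exact star_ne_zero.2 (hz u (Finset.mem_of_mem_erase hu))

variable [Fintype V]

/-- In a row of `V₂`, the factor `star (d v)` completes the product to one independent of `v`,
leaving the block equation for `x`. -/
theorem kernelVector_mem (h : IsScaledHamiltonian G V₁ V₂ P d H)
    (hsemi : G.IsSemiBipartite V₁ V₂) (hx : G.IsKernelAmplitude V₁ V₂ P x) :
    kernelVector V₁ x d ∈ zeroSpace H := by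
  rw [mem_zeroSpace_iff]
  intro u
  rw [hsemi.sum_univ, Finset.sum_eq_zero (s := V₂) fun v hv => by
    rw [kernelVector_apply, hx.eq_zero v (hsemi.notMem_left hv), zero_mul, mul_zero], add_zero]
  by_cases hu : u ∈ V₁
  · exact Finset.sum_eq_zero fun v hv => by rw [h.within u hu v hv, zero_mul]
  · have hu' := hsemi.mem_right hu
    have e : ∀ v ∈ V₁, H u v * kernelVector V₁ x d v =
        (∏ w ∈ V₁, star (d w)) * (G.weight u v * x v) := by
      intro v hv
      rw [h.right v hv u hu', kernelVector_apply, ← Finset.mul_prod_erase V₁ _ hv]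
      ring
    rw [Finset.sum_congr rfl e, ← Finset.mul_sum, hx.sum_eq_zero u hu', mul_zero]

theorem exists_eq_smul_kernelVector (h : IsScaledHamiltonian G V₁ V₂ P d H)
    (hsemi : G.IsSemiBipartite V₁ V₂) (hx : G.IsKernelAmplitude V₁ V₂ P x)
    {y : EuclideanSpace ℂ V} (hy : y ∈ zeroSpace H) : ∃ c : ℂ, y = c • kernelVector V₁ x d := by
  rw [mem_zeroSpace_iff] at hy
  set r : V → ℂ := fun v => ∑ u ∈ V₂, G.weight v u * y u with hr
  have hdr : ∀ v ∈ V₁, d v * r v = 0 := by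
    intro v hv
    have := hy v
    rw [hsemi.sum_univ, Finset.sum_eq_zero (s := V₁) fun u hu => by
      rw [h.within v hv u hu, zero_mul], zero_add,
      Finset.sum_congr rfl fun u hu => by rw [h.left v hv u hu, mul_assoc], ← Finset.mul_sum] at this
    exact this
  -- `r` is the adjoint block applied to `y`, so it is orthogonal to `x ∈ ker B`. By `hdr` it lives
  -- on the at most one vertex where `d` vanishes, and there `x ≠ 0`; so `r = 0`.
  have hxr : ∑ v ∈ V₁, star (x v) * r v = 0 := by
    have e : ∀ v, star (x v) * r v = ∑ u ∈ V₂, y u * star (G.weight u v * x v) := by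
      intro v
      rw [hr, Finset.mul_sum]
      refine Finset.sum_congr rfl fun u _ => ?_
      rw [star_mul', ← G.weight_conj]
      ring
    rw [Finset.sum_congr rfl fun v _ => e v, Finset.sum_comm]
    refine Finset.sum_eq_zero fun u hu => ?_
    rw [← Finset.mul_sum, ← star_sum, hx.sum_eq_zero u hu, star_zero, mul_zero]
  have hr0 : ∀ v ∈ V₁, r v = 0 := by
    intro v hv
    by_cases hd : d v = 0
    · rw [Finset.sum_eq_single_of_mem v hv fun u hu huv => by
        rw [(mul_eq_zero.1 (hdr u hu)).resolve_left fun h0 => huv (h.unique u hu v hv h0 hd),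
          mul_zero]] at hxr
      exact (mul_eq_zero.1 hxr).resolve_left
        (star_ne_zero.2 (hx.ne_zero v (h.mem v hv hd)))
    · exact (mul_eq_zero.1 (hdr v hv)).resolve_left hd
  have hy2 : ∀ u ∈ V₂, y u = 0 := hx.injective _ hr0
  obtain ⟨c, hc⟩ := hx.exists_smul (fun v => star (d v) * y v) fun u hu => by
    have := hy u
    rw [hsemi.sum_univ, Finset.sum_eq_zero (s := V₂) fun v hv => by rw [hy2 v hv, mul_zero],
      add_zero] at this
    rw [← this]
    refine Finset.sum_congr rfl fun v hv => ?_
    rw [h.right v hv u hu]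
    ring
  -- Now `star d * y = c * x` on `V₁`. A zero of `d` at `p` forces `c = 0`, so only `y p` survives;
  -- otherwise one divides by `star d`.
  by_cases hz : ∃ p ∈ V₁, d p = 0
  · obtain ⟨p, hp, hd⟩ := hz
    have hxp := hx.ne_zero p (h.mem p hp hd)
    have hprod := h.prod_erase_ne_zero hp hd
    have hc0 : c = 0 := by
      have := hc p hp
      simp only [hd, star_zero, zero_mul] at this
      exact (mul_eq_zero.1 this.symm).resolve_right hxp
    refine ⟨y p / (x p * ∏ u ∈ V₁.erase p, star (d u)), ?_⟩
    rw [kernelVector_eq_single hp hd, smul_smul, div_mul_cancel₀ _ (mul_ne_zero hxp hprod)]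
    ext v
    rw [PiLp.smul_apply, PiLp.single_apply]
    split_ifs with hv
    · rw [hv, smul_eq_mul, mul_one]
    · rw [smul_zero]
      by_cases hv1 : v ∈ V₁
      · have := hc v hv1
        rw [hc0, zero_mul] at this
        exact (mul_eq_zero.1 this).resolve_left
          (star_ne_zero.2 fun h0 => hv (h.unique v hv1 p hp h0 hd))
      · exact hy2 v (hsemi.mem_right hv1)
  · push Not at hz
    have hprod : ∏ w ∈ V₁, star (d w) ≠ 0 :=
      Finset.prod_ne_zero_iff.2 fun u hu => star_ne_zero.2 (hz u hu)
    refine ⟨c / ∏ w ∈ V₁, star (d w), ?_⟩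
    ext v
    rw [PiLp.smul_apply, kernelVector_apply, smul_eq_mul]
    by_cases hv : v ∈ V₁
    · have h1 := hc v hv
      have h2 := Finset.mul_prod_erase V₁ (fun w => star (d w)) hv
      have h3 : star (d v) ≠ 0 := star_ne_zero.2 (hz v hv)
      rw [div_mul_eq_mul_div, eq_div_iff hprod, ← h2]
      linear_combination (∏ u ∈ V₁.erase v, star (d u)) * h1
    · rw [hy2 v (hsemi.mem_right hv), hx.eq_zero v hv, zero_mul, mul_zero]

end IsScaledHamiltonian

end Kernel

/-! ### The control path and the change of time scale -/

theorem AbsolutelyContinuousOnInterval.pi {ι X : Type*} [Fintype ι] [PseudoMetricSpace X]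
    {f : ι → ℝ → X} {a b : ℝ} (hf : ∀ i, AbsolutelyContinuousOnInterval (f i) a b) :
    AbsolutelyContinuousOnInterval (fun t i => f i t) a b := by
  refine squeeze_zero (fun t => Finset.sum_nonneg fun i _ => dist_nonneg) (fun E => ?_)
    (by simpa using tendsto_finsetSum Finset.univ fun i _ => hf i)
  rw [Finset.sum_comm]
  refine Finset.sum_le_sum fun j _ => ?_
  refine (dist_pi_le_iff (Finset.sum_nonneg fun i _ => dist_nonneg)).2 fun i => ?_
  exact Finset.single_le_sum (f := fun i => dist (f i (E.2 j).1) (f i (E.2 j).2))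
    (fun i _ => dist_nonneg) (Finset.mem_univ i)

section Hamiltonians

variable {V : Type*} [Fintype V] [DecidableEq V] {G : WeightedGraph V} {V₁ V₂ P : Finset V}

/-- Smoothness is over `ℝ` because the products contain conjugates. -/
theorem contDiff_kernelVector (x : V → ℂ) : ContDiff ℝ 1 (kernelVector V₁ x) := by
  unfold kernelVector
  refine (PiLp.continuousLinearEquiv 2 ℝ (fun _ : V => ℂ)).symm.contDiff.comp
    (contDiff_pi.2 fun v => contDiff_const.mul (contDiff_prod fun u _ => ?_))
  exact (starL' ℝ : ℂ ≃L[ℝ] ℂ).contDiff.comp (contDiff_apply ℝ ℂ u)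

theorem continuousOn_kernelVector (x : V → ℂ) {g : V → ℝ → ℂ} {s : Set ℝ}
    (hg : ∀ v ∈ V₁, ContinuousOn (g v) s) :
    ContinuousOn (fun t => kernelVector V₁ x fun v => g v t) s := by
  have h : ContinuousOn (fun t => kernelVector V₁ x fun v => if v ∈ V₁ then g v t else 0) s := by
    refine (contDiff_kernelVector x).continuous.comp_continuousOn (continuousOn_pi.2 fun v => ?_)
    split_ifs with hv
    · exact hg v hv
    · exact continuousOn_const
  simpa only [kernelVector_ite x fun v => g v _] using h

theorem absolutelyContinuousOnInterval_kernelVector (x : V → ℂ) {g : V → ℝ → ℂ} {a b : ℝ}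
    (hg : ∀ v ∈ V₁, AbsolutelyContinuousOnInterval (g v) a b) :
    AbsolutelyContinuousOnInterval (fun t => kernelVector V₁ x fun v => g v t) a b := by
  have h : AbsolutelyContinuousOnInterval
      (fun t => kernelVector V₁ x fun v => if v ∈ V₁ then g v t else 0) a b := by
    refine AbsolutelyContinuousOnInterval.contDiff_comp (contDiff_kernelVector x)
      (AbsolutelyContinuousOnInterval.pi (f := fun v t => if v ∈ V₁ then g v t else 0) fun v => ?_)
    split_ifs with hv
    · exact hg v hv
    · exact (LipschitzWith.const (0 : ℂ)).lipschitzOnWith.absolutelyContinuousOnInterval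
  simpa only [kernelVector_ite x fun v => g v _] using h

/-- The continuous linear operator of a matrix. -/
noncomputable def Matrix.toEuclideanOp (A : Matrix V V ℂ) :
    EuclideanSpace ℂ V →L[ℂ] EuclideanSpace ℂ V :=
  LinearMap.toContinuousLinearMap (Matrix.toEuclideanLin A)

theorem Matrix.toEuclideanOp_apply (A : Matrix V V ℂ) (x : EuclideanSpace ℂ V) :
    A.toEuclideanOp x = Matrix.toEuclideanLin A x := rfl

theorem Matrix.toEuclideanOp_eq_zero_iff {A : Matrix V V ℂ} {x : EuclideanSpace ℂ V} :
    A.toEuclideanOp x = 0 ↔ x ∈ zeroSpace A := Iff.rfl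

theorem Matrix.continuous_toEuclideanOp :
    Continuous (Matrix.toEuclideanOp : Matrix V V ℂ → _) := by
  let Φ : Matrix V V ℂ →ₗ[ℂ] (EuclideanSpace ℂ V →L[ℂ] EuclideanSpace ℂ V) :=
    LinearMap.toContinuousLinearMap.toLinearMap ∘ₗ Matrix.toEuclideanLin.toLinearMap
  exact Φ.continuous_of_finiteDimensional

variable {f : V → V → ℝ → ℂ} {g : V → ℝ → ℂ} {T : ℝ} {a b : V}

theorem IsCommensurate.continuousOn_controlHamiltonian (hf : IsCommensurate V₁ V₂ T f g)
    (hsemi : G.IsSemiBipartite V₁ V₂) (hg : ∀ v ∈ V₁, ContinuousOn (g v) (Icc 0 T)) :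
    ContinuousOn (G.controlHamiltonian f) (Icc 0 T) := by
  refine continuousOn_pi.2 fun u => continuousOn_pi.2 fun v => ?_
  change ContinuousOn (fun t => f u v t * G.weight u v) (Icc 0 T)
  by_cases hu : u ∈ V₁ <;> by_cases hv : v ∈ V₁
  · simp only [hsemi.weight_eq_zero hu hv, mul_zero]
    exact continuousOn_const
  · exact ((hg u hu).congr fun t ht => hf.between t ht u hu v (hsemi.mem_right hv)).mul
      continuousOn_const
  · refine ((hg v hv).star.congr fun t ht => ?_).mul continuousOn_const
    rw [hf.conj t ht, hf.between t ht v hv u (hsemi.mem_right hu)]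
  · exact ((continuousOn_const (c := (1 : ℂ))).congr fun t ht =>
      hf.within t ht u (hsemi.mem_right hu) v (hsemi.mem_right hv)).mul continuousOn_const

theorem IsCommensurate.inner_toEuclideanOp (hf : IsCommensurate V₁ V₂ T f g) {t : ℝ}
    (ht : t ∈ Icc 0 T) (x y : EuclideanSpace ℂ V) :
    inner ℂ ((G.controlHamiltonian f t).toEuclideanOp x) y =
      inner ℂ x ((G.controlHamiltonian f t).toEuclideanOp y) := by
  have h : (G.controlHamiltonian f t).IsHermitian := by
    ext u v
    change star (f v u t * G.weight v u) = f u v t * G.weight u v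
    rw [star_mul', ← hf.conj t ht, ← G.weight_conj]
  exact Matrix.isSymmetric_toEuclideanLin_iff.2 h x y

theorem IsTransferScheme.isScaledHamiltonian (hg : IsTransferScheme V₁ P a b T g)
    (hf : IsCommensurate V₁ V₂ T f g) (hsemi : G.IsSemiBipartite V₁ V₂) {t : ℝ}
    (ht : t ∈ Icc 0 T) :
    IsScaledHamiltonian G V₁ V₂ P (fun v => g v t) (G.controlHamiltonian f t) where
  left v hv u hu := by
    change f v u t * G.weight v u = _
    rw [hf.between t ht v hv u hu]
  right v hv u hu := by
    change f u v t * G.weight u v = _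
    rw [hf.conj t ht, hf.between t ht v hv u hu]
  within u hu v hv := by
    change f u v t * G.weight u v = _
    rw [hsemi.weight_eq_zero hu hv, mul_zero]
  mem v hv h0 := by
    by_contra hv'
    exact hg.ne_zero v hv hv' t ht h0
  unique u hu v hv h0 h0' := by
    by_contra huv
    exact hg.not_both_zero u hu v hv huv t ht ⟨h0, h0'⟩

theorem adiabaticallyTransfers_of_parallel {H : ℝ → Matrix V V ℂ} {z : ℝ → EuclideanSpace ℂ V}
    (hT : 0 < T) (hH : ContinuousOn H (Icc 0 T)) (hpath : IsZeroEigenstatePath H T a b z)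
    (hz : AbsolutelyContinuousOnInterval z 0 T)
    (hk : ∀ t ∈ Icc 0 T, IsUnitKernelVector (H t).toEuclideanOp (z t))
    (hpar : ∀ᵐ t, t ∈ Icc 0 T → inner ℂ (z t) (deriv z t) = 0) {hbar : ℝ} (hbar0 : 0 < hbar) :
    AdiabaticallyTransfers hbar H T a b := by
  refine ⟨z, hpath, fun δ hδ => ?_⟩
  have hHc := Matrix.continuous_toEuclideanOp.comp_continuousOn hH
  obtain ⟨l₀, hl₀, hl⟩ := adiabatic_following hT.le hHc hz hk hpar hδ
  -- In the protocol time `s = T t / τ` the equation becomes `φ' = -i l H φ` with `l = τ / (T ħ)`.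
  refine ⟨l₀ * (T * hbar), by positivity, fun τ hτ => ?_⟩
  have hτ0 : 0 < τ := lt_of_lt_of_le (by positivity) hτ
  have hmem : ∀ t ∈ Icc 0 τ, T * t / τ ∈ Icc 0 T := fun t ht =>
    ⟨div_nonneg (mul_nonneg hT.le ht.1) hτ0.le, by
      rw [div_le_iff₀ hτ0]
      exact mul_le_mul_of_nonneg_left ht.2 hT.le⟩
  have hbarC : (hbar : ℂ) ≠ 0 := by exact_mod_cast hbar0.ne'
  constructor
  · obtain ⟨ψ, h0, hψ⟩ := exists_hasDerivWithinAt_of_skew (T := τ) hτ0.le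
      (A := fun t => (-(Complex.I / hbar)) • (H (T * t / τ)).toEuclideanOp)
      ((hHc.comp (f := fun t => T * t / τ) (by fun_prop) hmem).const_smul
        (-(Complex.I / (hbar : ℂ)))) (fun t ht x => by
        simp only [smul_apply, inner_smul_left, inner_smul_right,
          (hk _ (hmem t ht)).symm]
        simp [neg_div])
      (x₀ := EuclideanSpace.single a 1) (by simp)
    refine ⟨ψ, fun t ht => ⟨_, hψ t ht, ?_⟩, h0⟩
    rw [smul_apply, smul_smul, Matrix.toEuclideanOp_apply]
    convert one_smul ℂ _ using 2
    field_simp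
    rw [Complex.I_sq, neg_neg]
  · intro ψ hψ hψ0 t ht
    have hmem' : ∀ s ∈ Icc 0 T, τ / T * s ∈ Icc 0 τ := fun s hs =>
      ⟨mul_nonneg (by positivity) hs.1, by
        rw [div_mul_eq_mul_div, div_le_iff₀ hT]
        exact mul_le_mul_of_nonneg_left hs.2 hτ0.le⟩
    have hinv : ∀ s, T * (τ / T * s) / τ = s := fun s => by field_simp
    have hinv' : τ / T * (T * t / τ) = t := by field_simp
    have key := hl (τ / (T * hbar)) (by rwa [le_div_iff₀ (by positivity)])
      (fun s => ψ (τ / T * s)) (by simp [hψ0, hpath.start]) (fun s hs => ?_) _ (hmem t ht)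
    · simpa only [hinv'] using key
    · obtain ⟨ψ', h1, h2⟩ := hψ _ (hmem' s hs)
      have h3 : HasDerivWithinAt (fun s => τ / T * s) (τ / T) (Icc 0 T) s := by
        simpa using (hasDerivWithinAt_id s (Icc 0 T)).const_mul (τ / T)
      have h4 := h1.scomp s h3 hmem'
      simp only [hinv] at h2
      refine h4.congr_deriv ?_
      rw [Function.comp_apply, Matrix.toEuclideanOp_apply, ← h2, smul_smul,
        ← Complex.coe_smul]
      congr 1
      have hTC : (T : ℂ) ≠ 0 := by exact_mod_cast hT.ne'
      push_cast
      field_simp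
      rw [Complex.I_sq]
      ring

end Hamiltonians

/-! ### Assembly of the theorem -/

theorem theorem1 {V : Type*} [Fintype V] [DecidableEq V] (G : WeightedGraph V)
    (V₁ V₂ P : Finset V) (hconn : G.Connected) (hsemi : G.IsSemiBipartite V₁ V₂)
    (hP : P ⊆ V₁) (hcard : V₁.card = V₂.card + 1)
    (h : (∀ p ∈ P, (G.deleteVertex p).adjMatrix.det ≠ 0) ∨
      (HasUniqueZeroEigenvector G.adjMatrix ∧
        ∀ x ∈ zeroSpace G.adjMatrix, x ≠ 0 → ∀ p ∈ P, x p ≠ 0))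
    (a b : V) (ha : a ∈ P) (hb : b ∈ P) (T : ℝ) (hT : 0 < T)
    (f : V → V → ℝ → ℂ) (g : V → ℝ → ℂ) (hf : IsCommensurate V₁ V₂ T f g)
    (hg : IsTransferScheme V₁ P a b T g) :
    (∀ t ∈ Set.Icc 0 T, HasUniqueZeroEigenvector (G.controlHamiltonian f t)) ∧
    (∃ z : ℝ → EuclideanSpace ℂ V, IsZeroEigenstatePath (G.controlHamiltonian f) T a b z) ∧
    (∃ ε > 0, HasGapAroundZero (G.controlHamiltonian f) T ε) ∧
    ((∀ v ∈ V₁, AbsolutelyContinuousOnInterval (g v) 0 T) →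
      ∀ hbar : ℝ, 0 < hbar → AdiabaticallyTransfers hbar (G.controlHamiltonian f) T a b) := by
  obtain ⟨x, hx⟩ := WeightedGraph.exists_isKernelAmplitude hsemi ⟨a, ha⟩ hcard h
  have hI0 : (0 : ℝ) ∈ Icc 0 T := ⟨le_rfl, hT.le⟩
  have hIT : T ∈ Icc 0 T := ⟨hT.le, le_rfl⟩
  have hs : ∀ t ∈ Icc 0 T,
      IsScaledHamiltonian G V₁ V₂ P (fun v => g v t) (G.controlHamiltonian f t) :=
    fun t ht => hg.isScaledHamiltonian hf hsemi ht
  -- The amplitude at `a` at time `0`; dividing by it makes the path start exactly at `|a⟩`.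
  set κ : ℂ := x a * ∏ u ∈ V₁.erase a, star (g u 0) with hκ
  have hκ0 : κ ≠ 0 := mul_ne_zero (hx.ne_zero a ha)
    ((hs 0 hI0).prod_erase_ne_zero (hP ha) hg.start)
  set ζ : ℝ → EuclideanSpace ℂ V := fun t => κ⁻¹ • kernelVector V₁ x fun v => g v t with hζ
  have hζ0 : ζ 0 = EuclideanSpace.single a 1 := by
    simp only [hζ]
    rw [kernelVector_eq_single (hP ha) hg.start, ← hκ, smul_smul, inv_mul_cancel₀ hκ0, one_smul]
  obtain ⟨k, hζT⟩ : ∃ k : ℂ, ζ T = k • EuclideanSpace.single b 1 := by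
    simp only [hζ]
    rw [kernelVector_eq_single (hP hb) hg.finish, smul_smul]
    exact ⟨_, rfl⟩
  have hζne : ∀ t ∈ Icc 0 T, ζ t ≠ 0 := fun t ht =>
    smul_ne_zero (inv_ne_zero hκ0) ((hs t ht).kernelVector_ne_zero hx)
  have hζmem : ∀ t ∈ Icc 0 T, ζ t ∈ zeroSpace (G.controlHamiltonian f t) := fun t ht =>
    Submodule.smul_mem _ _ ((hs t ht).kernelVector_mem hsemi hx)
  have hζspan : ∀ t ∈ Icc 0 T, ∀ y ∈ zeroSpace (G.controlHamiltonian f t),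
      ∃ c : ℂ, y = c • ζ t := fun t ht y hy => by
    obtain ⟨c, hc⟩ := (hs t ht).exists_eq_smul_kernelVector hsemi hx hy
    exact ⟨c * κ, by rw [hc, smul_smul, mul_assoc, mul_inv_cancel₀ hκ0, mul_one]⟩
  have hH : ContinuousOn (G.controlHamiltonian f) (Icc 0 T) :=
    hf.continuousOn_controlHamiltonian hsemi hg.continuousOn
  have hHc := Matrix.continuous_toEuclideanOp.comp_continuousOn hH
  have hζc : ContinuousOn ζ (Icc 0 T) :=
    (continuousOn_kernelVector x hg.continuousOn).const_smul κ⁻¹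
  -- A rescaling of `ζ` to unit length is a path of zero eigenstates.
  have hrescale : ∀ c : ℝ → ℂ, c 0 = 1 → ContinuousOn (fun t => c t • ζ t) (Icc 0 T) →
      (∀ t ∈ Icc 0 T, ‖c t • ζ t‖ = 1) →
      IsZeroEigenstatePath (G.controlHamiltonian f) T a b (fun t => c t • ζ t) ∧
      ∀ t ∈ Icc 0 T, IsUnitKernelVector (G.controlHamiltonian f t).toEuclideanOp (c t • ζ t) := by
    intro c hc0 hcont hnorm
    refine ⟨⟨hcont, hnorm, fun t ht => Submodule.smul_mem _ _ (hζmem t ht), ?_, c T * k, ?_, ?_⟩,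
      fun t ht => ⟨hf.inner_toEuclideanOp ht, hnorm t ht, ?_, fun y hy => ?_⟩⟩
    · rw [hc0, one_smul, hζ0]
    · have := hnorm T hIT
      rw [hζT, smul_smul, norm_smul] at this
      simpa using this
    · rw [hζT, smul_smul]
    · exact Matrix.toEuclideanOp_eq_zero_iff.2 (Submodule.smul_mem _ _ (hζmem t ht))
    · obtain ⟨e, he⟩ := hζspan t ht y (Matrix.toEuclideanOp_eq_zero_iff.1 hy)
      have hct : c t ≠ 0 := fun h0 => by
        have := hnorm t ht
        rw [h0, zero_smul, norm_zero] at this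
        exact zero_ne_one this
      exact ⟨e * (c t)⁻¹, by rw [he, mul_smul, inv_smul_smul₀ hct]⟩
  have hnorm0 : ‖ζ 0‖ = 1 := by rw [hζ0]; simp
  -- Division by the norm needs only continuous controls and serves the path and the gap. The
  -- adiabatic claim uses the parallel transported rescaling instead.
  have hnormalized := hrescale (fun t => ((‖ζ t‖⁻¹ : ℝ) : ℂ)) (by simp [hnorm0])
    ((Complex.continuous_ofReal.comp_continuousOn
      (hζc.norm.inv₀ fun t ht => norm_ne_zero_iff.2 (hζne t ht))).smul hζc)
    (fun t ht => by
      rw [norm_smul, Complex.norm_real, norm_inv, norm_norm,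
        inv_mul_cancel₀ (norm_ne_zero_iff.2 (hζne t ht))])
  refine ⟨fun t ht => ?_, ⟨_, hnormalized.1⟩, ?_, fun hac hbar hbar0 => ?_⟩
  · refine (finrank_eq_one_iff_of_nonzero' (⟨ζ t, hζmem t ht⟩ : zeroSpace _)
      (fun h0 => hζne t ht (congrArg Subtype.val h0))).2 fun y => ?_
    obtain ⟨c, hc⟩ := hζspan t ht y y.2
    exact ⟨c, Subtype.ext hc.symm⟩
  · obtain ⟨ε, hε, hgap⟩ := exists_gap hHc hnormalized.1.continuousOn hnormalized.2
    refine ⟨ε, hε, fun t ht μ hμ hμ0 => ?_⟩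
    obtain ⟨y, hy⟩ := hμ.exists_hasEigenvector
    exact hgap t ht μ y hy.apply_eq_smul hy.2 hμ0
  · obtain ⟨c, hc0, hcac, hcn, hpar⟩ := exists_parallel_transport hT.le
      ((absolutelyContinuousOnInterval_kernelVector x hac).const_smul κ⁻¹) hζne hnorm0
    have hcont : ContinuousOn (fun t => c t • ζ t) (Icc 0 T) := by
      have := hcac.continuousOn
      rwa [uIcc_of_le hT.le] at this
    have hp := hrescale c hc0 hcont hcn
    exact adiabaticallyTransfers_of_parallel hT hH hp.1 hcac hp.2 hpar hbar0
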